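/- Let $\mathbb{F}_q$ be a finite field of characteristic $2$ with $q$ elements, let $\nu\ge 0$ be an integer and $n=2\nu+2$. Let $$S=S_{2\nu+2}=\begin{pmatrix}0&I^{(\nu)}&&\\ I^{(\nu)}&0&&\\ &&0&1\\ &&1&1\end{pmatrix}$$ (an $n\times n$ matrix over $\mathbb{F}_q$, with $I^{(\nu)}$ the $\nu\times\nu$ identity matrix and blank entries zero), and let $$Ps_n(\mathbb{F}_q,S)=\{T\in \mathrm{GL}_n(\mathbb{F}_q): T\,S\,{}^tT=S\}$$ be the pseudo-symplectic group. Let each $T\in\mathrm{GL}_n(\mathbb{F}_q)$ act on the rational function field $\mathbb{F}_q(X_1,\ldots,X_n)$ by the $\mathbb{F}_q$-automorphism $\sigma_T$ with $(\sigma_T(X_1),\ldots,\sigma_T(X_n))=(X_1,\ldots,X_n)T$, and for a subgroup $G$ of $\mathrm{GL}_n(\mathbb{F}_q)$ put $$\mathbb{F}_q(X_1,\ldots,X_n)^{G}=\{f\in\mathbb{F}_q(X_1,\ldots,X_n): \sigma_T(f)=f\text{ for all }T\in G\}.$$ For $k=0,1,2,\ldots$ let $$P_{nk}=(X_1,\ldots,X_n)\,S\,\begin{pmatrix}X_1^{q^k}\\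 \vdots\\ X_n^{q^k}\end{pmatrix}.$$ Then $$\mathbb{F}_q(X_1,\ldots,X_n)^{Ps_n(\mathbb{F}_q,S)}=\mathbb{F}_q(P_{n1},\ldots,P_{n,n-1},X_n).$$ -/

import Mathlib

open MvPolynomial

namespace PseudoSymplectic

section Action

variable {F : Type*} [Field F] {n : ℕ}

/-- The linear substitution `(X₁, …, Xₙ) ↦ (X₁, …, Xₙ) T` on polynomials. -/
noncomputable def polySubst (T : Matrix (Fin n) (Fin n) F) :
    MvPolynomial (Fin n) F →ₐ[F] MvPolynomial (Fin n) F :=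
  aeval fun j => ∑ i, X i * C (T i j)

theorem polySubst_X (T : Matrix (Fin n) (Fin n) F) (j : Fin n) :
    polySubst T (X j) = ∑ i, X i * C (T i j) := by
  simp [polySubst]

theorem polySubst_one : polySubst (1 : Matrix (Fin n) (Fin n) F) = AlgHom.id F _ := by
  apply MvPolynomial.algHom_ext
  intro j
  rw [polySubst_X, Finset.sum_eq_single j]
  · simp
  · intro i _ hij
    simp [Matrix.one_apply_ne hij]
  · simp

theorem polySubst_mul (T U : Matrix (Fin n) (Fin n) F) :
    polySubst (T * U) = (polySubst T).comp (polySubst U) := by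
  apply MvPolynomial.algHom_ext
  intro j
  have hC : ∀ (M : Matrix (Fin n) (Fin n) F) (a : F), polySubst M (C a) = C a := fun M a => by
    simp [polySubst]
  simp only [AlgHom.comp_apply, polySubst_X, map_sum, map_mul, hC, Matrix.mul_apply,
    Finset.mul_sum, Finset.sum_mul]
  rw [Finset.sum_comm]
  exact Finset.sum_congr rfl fun i _ => Finset.sum_congr rfl fun k _ => by ring

/-- The substitution by an invertible matrix, as an action of `GLₙ` on the polynomial ring. -/
noncomputable def polySubstHom :
    GL (Fin n) F →* (MvPolynomial (Fin n) F ≃ₐ[F] MvPolynomial (Fin n) F) where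
  toFun T := AlgEquiv.ofAlgHom (polySubst T.val) (polySubst T⁻¹.val)
    (by rw [← polySubst_mul, ← Units.val_mul, mul_inv_cancel, Units.val_one, polySubst_one])
    (by rw [← polySubst_mul, ← Units.val_mul, inv_mul_cancel, Units.val_one, polySubst_one])
  map_one' := by
    ext1 p
    simp [polySubst_one]
  map_mul' T U := by
    ext1 p
    simp [polySubst_mul]

/-- The rational function field `F(X₁, …, Xₙ)`. -/
abbrev RatFunc (n : ℕ) (F : Type*) [Field F] : Type _ :=
  FractionRing (MvPolynomial (Fin n) F)

/-- The indeterminate `Xᵢ` as a rational function. -/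
noncomputable def ratX (i : Fin n) : RatFunc n F :=
  algebraMap (MvPolynomial (Fin n) F) (RatFunc n F) (X i)

/-- The action `T ↦ σ_T` of `GLₙ(F)` on `F(X₁, …, Xₙ)` by `F`-algebra automorphisms, given by
`(σ_T X₁, …, σ_T Xₙ) = (X₁, …, Xₙ) T`. -/
noncomputable def sigma : GL (Fin n) F →* (RatFunc n F ≃ₐ[F] RatFunc n F) :=
  (IsFractionRing.fieldEquivOfAlgEquivHom F (RatFunc n F)).comp polySubstHom

theorem sigma_ratX (T : GL (Fin n) F) (j : Fin n) :
    sigma T (ratX j) = ∑ i, ratX i * algebraMap F (RatFunc n F) (T i j) := by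
  have h : sigma T (ratX j) = algebraMap (MvPolynomial (Fin n) F) (RatFunc n F)
      (polySubst T.val (X j)) :=
    IsFractionRing.fieldEquivOfAlgEquiv_algebraMap F (RatFunc n F) (RatFunc n F)
      (polySubstHom T) (X j)
  rw [h, polySubst_X, map_sum]
  refine Finset.sum_congr rfl fun i _ => ?_
  rw [map_mul, ← MvPolynomial.algebraMap_eq, ← IsScalarTower.algebraMap_apply]
  rfl

/-- The invariant subfield `F(X₁, …, Xₙ)^G = {f | σ_T f = f for all T ∈ G}`. -/
noncomputable def invariantField (G : Subgroup (GL (Fin n) F)) :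
    IntermediateField F (RatFunc n F) :=
  IntermediateField.fixedField (G.map sigma)

theorem mem_invariantField (G : Subgroup (GL (Fin n) F)) (f : RatFunc n F) :
    f ∈ invariantField G ↔ ∀ T ∈ G, sigma T f = f := by
  simp [invariantField]

/-- The group `{T ∈ GLₙ(F) | T S ᵗT = S}`. -/
def congruenceGroup (S : Matrix (Fin n) (Fin n) F) : Subgroup (GL (Fin n) F) where
  carrier := {T | T.val * S * T.val.transpose = S}
  one_mem' := by simp
  mul_mem' {T U} hT hU := by
    have hT' : T.val * S * T.val.transpose = S := hT
    have hU' : U.val * S * U.val.transpose = S := hU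
    change (T * U).val * S * (T * U).val.transpose = S
    calc (T * U).val * S * (T * U).val.transpose
        = T.val * (U.val * S * U.val.transpose) * T.val.transpose := by
          simp only [Units.val_mul, Matrix.transpose_mul, Matrix.mul_assoc]
      _ = S := by rw [hU', hT']
  inv_mem' {T} hT := by
    have hT' : T.val * S * T.val.transpose = S := hT
    have h1 : T⁻¹.val * T.val = 1 := by rw [← Units.val_mul, inv_mul_cancel, Units.val_one]
    have h2 : T.val.transpose * T⁻¹.val.transpose = 1 := by
      rw [← Matrix.transpose_mul, h1, Matrix.transpose_one]
    change T⁻¹.val * S * T⁻¹.val.transpose = S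
    calc T⁻¹.val * S * T⁻¹.val.transpose
        = T⁻¹.val * (T.val * S * T.val.transpose) * T⁻¹.val.transpose := by rw [hT']
      _ = (T⁻¹.val * T.val) * S * (T.val.transpose * T⁻¹.val.transpose) := by
          simp only [Matrix.mul_assoc]
      _ = S := by rw [h1, h2, Matrix.one_mul, Matrix.mul_one]

/-- For a matrix `S` over a finite field with `q` elements, the form
`Pₙₖ = (X₁, …, Xₙ) S ᵗ(X₁^(q^k), …, Xₙ^(q^k))`. -/
noncomputable def formP [Fintype F] (S : Matrix (Fin n) (Fin n) F) (k : ℕ) : RatFunc n F :=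
  dotProduct (fun i : Fin n => ratX i)
    ((S.map (algebraMap F (RatFunc n F))).mulVec fun j => ratX j ^ (Fintype.card F ^ k))

end Action

/-- Consecutive numbering of the block indices `ν + ν + 2` by `1, …, 2ν + 2` (from `0` here). -/
def blockIndex (ν : ℕ) : (Fin ν ⊕ Fin ν) ⊕ Fin 2 ≃ Fin (2 * ν + 2) :=
  ((finSumFinEquiv.sumCongr (Equiv.refl (Fin 2))).trans finSumFinEquiv).trans
    (finCongr (by omega))

/-- The matrix `S_{2ν+2}`, with diagonal blocks `(0 I; I 0)` (of size `2ν`) and `(0 1; 1 1)`. -/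
def matrixS (ν : ℕ) (F : Type*) [Field F] : Matrix (Fin (2 * ν + 2)) (Fin (2 * ν + 2)) F :=
  Matrix.reindex (blockIndex ν) (blockIndex ν)
    (Matrix.fromBlocks (Matrix.fromBlocks 0 1 1 0) 0 0 !![0, 1; 1, 1])

/-- The pseudo-symplectic group `Ps_{2ν+2}(F, S_{2ν+2})`. -/
def Ps (ν : ℕ) (F : Type*) [Field F] : Subgroup (GL (Fin (2 * ν + 2)) F) :=
  congruenceGroup (matrixS ν F)

end PseudoSymplectic

/-!
Write `q` for the order of `F`, `x = (X₁, …, Xₙ)`, `x⁽ᵏ⁾` for the vector of `q ^ k`-th powers, and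
`B` for the symmetric nondegenerate bilinear form with matrix `S`, so that `Pₙₖ = B(x, x⁽ᵏ⁾)`. Let
`K` be the field on the right-hand side.

The forms are invariant because a matrix over `F` commutes with the Frobenius. In characteristic `2`
one has `Pₙ₀ = Xₙ ^ 2` (`bilin_matrixS_self`), so `Xₙ` is invariant too, which gives `K ⊆ L^G` where
`L = F(X₁, …, Xₙ)` and `G` is the group of `S`.

For the other inclusion, the key is that coordinates with respect to a basis lie in `K` as soon as
the Gram matrix of the basis and the pairings with the basis vectors do (`coord_mem_of_gram_mem`).
Since `B(x⁽ⁱ⁾, x⁽ⁱ⁺ᵏ⁾) = Pₙₖ ^ q ^ i`, all pairings of two among `x⁽⁰⁾, …, x⁽ⁿ⁾` are in `K`, except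
possibly `Pₙₙ = B(x, x⁽ⁿ⁾)`. The linear functional `Xₙ` is `B(e, ·)` for a vector `e` over `F`, and
`e, x⁽¹⁾, …, x⁽ⁿ⁻¹⁾` is a basis; expressing `x⁽ⁿ⁾` in this basis and pairing with `x` gives `Pₙₙ ∈ K`
(`bilin_frobVec_mem_of_row_mem`). Now the basis `x⁽⁰⁾, …, x⁽ⁿ⁻¹⁾` gives `x⁽ⁿ⁾ = ∑ cᵢ x⁽ⁱ⁾` with all
`cᵢ` in `K` (`exists_additive_relation`). The polynomial `t ^ q ^ n - ∑ cᵢ t ^ q ^ i` over `K` has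
exactly the `q ^ n` distinct roots `∑ aᵢ Xᵢ` with `aᵢ ∈ F`, hence `L / K` is Galois, and an
automorphism of `L / K` is a linear substitution `x ↦ x T` over `F` (`isGalois_of_additive_relation`).
As it fixes the `B(x, x⁽ᵏ⁾)` and the `x⁽ᵏ⁾` with `k < n` form a basis, `T S Tᵀ = S`
(`mul_mul_transpose_eq_of_bilin_eq`). Thus the Galois group of `L / K` consists of elements of `G`,
and `L^G ⊆ K`.

Both bases come down to the nonsingularity of Moore matrices (`moore_injective`).
-/

namespace PseudoSymplectic

/-! ### Additive polynomials over a finite field -/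

section Frobenius

variable {F L : Type*} [Field F] [Fintype F] [Field L] [Algebra F L]

theorem frobeniusAlgHom_pow_apply (k : ℕ) (y : L) :
    (FiniteField.frobeniusAlgHom F L ^ k) y = y ^ Fintype.card F ^ k := by
  rw [AlgHom.coe_pow, FiniteField.coe_frobeniusAlgHom, pow_iterate]

theorem sum_smul_pow_card_pow {ι : Type*} [Fintype ι] (t : ι → F) (x : ι → L) (k : ℕ) :
    (∑ i, t i • x i) ^ Fintype.card F ^ k = ∑ i, t i • x i ^ Fintype.card F ^ k := by
  simp only [← frobeniusAlgHom_pow_apply (F := F), map_sum, map_smul]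

theorem linearIndependent_pow_card {ι : Type*} {x : ι → L} (hx : LinearIndependent F x) (k : ℕ) :
    LinearIndependent F fun i => x i ^ Fintype.card F ^ k := by
  have h := hx.map' (FiniteField.frobeniusAlgHom F L ^ k).toLinearMap
    (LinearMap.ker_eq_bot.mpr (RingHom.injective (FiniteField.frobeniusAlgHom F L ^ k).toRingHom))
  simpa only [Function.comp_def, AlgHom.toLinearMap_apply, frobeniusAlgHom_pow_apply] using h

open Classical in
/-- The `F`-span of a finite family, as a finite set. -/
noncomputable def finsetSpan (F : Type*) {L : Type*} [Field F] [Fintype F] [Field L] [Algebra F L]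
    {n : ℕ} (x : Fin n → L) : Finset L :=
  Finset.univ.image fun t : Fin n → F => ∑ i, t i • x i

theorem mem_finsetSpan {n : ℕ} {x : Fin n → L} {y : L} :
    y ∈ finsetSpan F x ↔ ∃ t : Fin n → F, ∑ i, t i • x i = y := by
  simp [finsetSpan]

theorem apply_mem_finsetSpan {n : ℕ} (x : Fin n → L) (j : Fin n) : x j ∈ finsetSpan F x := by
  classical
  exact mem_finsetSpan.mpr ⟨Pi.single j 1, by simp [Pi.single_apply]⟩

theorem card_finsetSpan {n : ℕ} {x : Fin n → L} (hx : LinearIndependent F x) :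
    (finsetSpan F x).card = Fintype.card F ^ n := by
  classical
  rw [finsetSpan, Finset.card_image_of_injective]
  · simp
  · exact linearIndependent_iff_injective_fintypeLinearCombination.mp hx

/-- Nonsingularity of the Moore matrix. An additive polynomial of degree at most `q ^ (n - 1)`
cannot vanish on the `q ^ n` elements of the span of `n` linearly independent elements. -/
theorem moore_injective {n : ℕ} {x : Fin n → L} (hx : LinearIndependent F x) {a : Fin n → L}
    (h : ∀ j, ∑ i, a i * x j ^ Fintype.card F ^ (i : ℕ) = 0) : a = 0 := by
  set q := Fintype.card F with hq
  have hq1 : 1 < q := Fintype.one_lt_card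
  let p : Polynomial L := ∑ i, Polynomial.C (a i) * Polynomial.X ^ q ^ (i : ℕ)
  have hp : p = 0 := by
    refine Polynomial.eq_zero_of_natDegree_lt_card_of_eval_eq_zero' p (finsetSpan F x) ?_ ?_
    · intro y hy
      obtain ⟨t, rfl⟩ := mem_finsetSpan.mp hy
      simp only [p, Polynomial.eval_finsetSum, Polynomial.eval_mul, Polynomial.eval_C,
        Polynomial.eval_pow, Polynomial.eval_X, hq, sum_smul_pow_card_pow, Finset.mul_sum]
      rw [Finset.sum_comm]
      refine Finset.sum_eq_zero fun j _ => ?_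
      simp only [mul_smul_comm, ← Finset.smul_sum]
      rw [← hq, h j, smul_zero]
    · rw [card_finsetSpan hx]
      refine lt_of_le_of_lt (Polynomial.natDegree_sum_le_of_forall_le (n := q ^ n - 1) _ _ ?_)
        (Nat.sub_lt (pow_pos (by omega) _) one_pos)
      intro i _
      refine (Polynomial.natDegree_C_mul_X_pow_le _ _).trans ?_
      have := Nat.pow_lt_pow_right hq1 i.2
      omega
  funext i
  have hi := congrArg (fun f => Polynomial.coeff f (q ^ (i : ℕ))) hp
  simp only [p, Polynomial.finsetSum_coeff, Polynomial.coeff_C_mul_X_pow,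
    Polynomial.coeff_zero] at hi
  rw [Finset.sum_eq_single i] at hi
  · simpa using hi
  · intro j _ hj
    rw [if_neg]
    intro he
    exact hj (Fin.ext (Nat.pow_right_injective hq1 he.symm))
  · simp

theorem isUnit_det_moore {n : ℕ} {x : Fin n → L} (hx : LinearIndependent F x) :
    IsUnit (Matrix.of fun i j : Fin n => x j ^ Fintype.card F ^ (i : ℕ)).det := by
  rw [isUnit_iff_ne_zero]
  intro h0
  obtain ⟨a, ha, h⟩ := Matrix.exists_vecMul_eq_zero_iff.mpr h0
  exact ha (moore_injective hx fun j => congrFun h j)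

/-- If the elements `x j` are linearly independent over the field with `q` elements and are roots
of the additive polynomial `t ^ q ^ n - ∑ i, c i * t ^ q ^ i` over `K`, then they generate a Galois
extension of `K`, and `K`-automorphisms act on them by matrices over `F`. -/
theorem isGalois_of_additive_relation {n : ℕ} {x : Fin n → L} (hx : LinearIndependent F x)
    (hgen : IntermediateField.adjoin F (Set.range x) = ⊤) (K : IntermediateField F L)
    (c : Fin n → K)
    (hc : ∀ j, x j ^ Fintype.card F ^ n = ∑ i, (c i : L) * x j ^ Fintype.card F ^ (i : ℕ)) :
    IsGalois K L ∧ ∀ (τ : L ≃ₐ[K] L) (j : Fin n), ∃ t : Fin n → F, ∑ i, t i • x i = τ (x j) := by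
  set q := Fintype.card F with hq
  have hq1 : 1 < q := Fintype.one_lt_card
  let r : Polynomial K := ∑ i, Polynomial.C (c i) * Polynomial.X ^ q ^ (i : ℕ)
  have hr : r.degree < (q ^ n : ℕ) := by
    refine lt_of_le_of_lt (Polynomial.degree_sum_le _ _) ?_
    rw [Finset.sup_lt_iff (WithBot.bot_lt_coe _)]
    intro i _
    exact lt_of_le_of_lt (Polynomial.degree_C_mul_X_pow_le _ _)
      (by exact_mod_cast Nat.pow_lt_pow_right hq1 i.2)
  let f : Polynomial K := Polynomial.X ^ q ^ n - r
  have hf : f.Monic := Polynomial.monic_X_pow_sub hr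
  have hdeg : f.natDegree = q ^ n := by
    refine Polynomial.natDegree_eq_of_degree_eq_some ?_
    rw [Polynomial.degree_sub_eq_left_of_degree_lt] <;> rw [Polynomial.degree_X_pow]
    exact hr
  have hroot : ∀ y ∈ finsetSpan F x, (f.map (algebraMap K L)).eval y = 0 := by
    intro y hy
    obtain ⟨t, rfl⟩ := mem_finsetSpan.mp hy
    simp only [f, r, Polynomial.map_sub, Polynomial.map_pow, Polynomial.map_X,
      Polynomial.map_sum, Polynomial.map_mul, Polynomial.map_C, Polynomial.eval_sub,
      Polynomial.eval_finsetSum, Polynomial.eval_mul, Polynomial.eval_C,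
      Polynomial.eval_pow, Polynomial.eval_X, hq, sum_smul_pow_card_pow, Finset.mul_sum]
    rw [Finset.sum_comm, sub_eq_zero]
    refine Finset.sum_congr rfl fun j _ => ?_
    simp only [mul_smul_comm, ← Finset.smul_sum]
    rw [← hq, hc j]
    rfl
  have hroots : (f.map (algebraMap K L)).roots = (finsetSpan F x).val := by
    refine Polynomial.roots_eq_of_natDegree_le_card_of_ne_zero hroot ?_ (hf.map _).ne_zero
    rw [card_finsetSpan hx, Polynomial.natDegree_map, hdeg]
  have hsplits : (f.map (algebraMap K L)).Splits := by
    rw [Polynomial.splits_iff_card_roots, hroots, Finset.card_val, card_finsetSpan hx,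
      Polynomial.natDegree_map, hdeg]
  have hsep : f.Separable := by
    rw [← Polynomial.separable_map (algebraMap K L),
      ← Polynomial.nodup_roots_iff_of_splits (hf.map _).ne_zero hsplits, hroots]
    exact Finset.nodup _
  have hrootSet : ∀ y, y ∈ f.rootSet L ↔ y ∈ finsetSpan F x := by
    intro y
    rw [Polynomial.mem_rootSet', ← Finset.mem_val, ← hroots, Polynomial.mem_roots',
      Polynomial.IsRoot.def, Polynomial.eval_map_algebraMap]
  have hsf : Polynomial.IsSplittingField K L f := by
    refine isSplittingField_iff_intermediateField.mpr ⟨hsplits, ?_⟩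
    have hle : (⊤ : IntermediateField F L) ≤
        (IntermediateField.adjoin K (f.rootSet L)).restrictScalars F := by
      rw [← hgen, IntermediateField.adjoin_le_iff]
      rintro _ ⟨j, rfl⟩
      exact IntermediateField.subset_adjoin K _ ((hrootSet _).mpr (apply_mem_finsetSpan x j))
    exact eq_top_iff.mpr fun y _ => hle (IntermediateField.mem_top (x := y))
  refine ⟨IsGalois.of_separable_splitting_field hsep, fun τ j => ?_⟩
  rw [← mem_finsetSpan, ← hrootSet, Polynomial.mem_rootSet]
  have hj := (hrootSet _).mpr (apply_mem_finsetSpan (F := F) x j)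
  rw [Polynomial.mem_rootSet] at hj
  exact ⟨hj.1, by rw [Polynomial.aeval_algEquiv, AlgHom.comp_apply, hj.2]; simp⟩

end Frobenius

/-! ### Coordinates from a Gram matrix -/

section Gram

/-- Coordinates of `w` with respect to a basis lie in a subfield `K` as soon as, for some
nondegenerate bilinear form, the Gram matrix of the basis and the values pairing `w` with the basis
vectors do. -/
theorem coord_mem_of_gram_mem {L ι : Type*} [Field L] [Fintype ι] [DecidableEq ι] (K : Subfield L)
    {S U : Matrix ι ι L} (hS : IsUnit S.det) (hU : IsUnit U.det) {c w : ι → L}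
    (hc : Matrix.vecMul c U = w)
    (hUU : ∀ i j, dotProduct (U i) (S.mulVec (U j)) ∈ K)
    (hwU : ∀ j, dotProduct w (S.mulVec (U j)) ∈ K) (i : ι) : c i ∈ K := by
  let H : Matrix ι ι K := Matrix.of fun i j => ⟨_, hUU i j⟩
  let h : ι → K := fun j => ⟨_, hwU j⟩
  have hent : ∀ (v : ι → L) j, Matrix.vecMul v (S * U.transpose) j =
      dotProduct v (S.mulVec (U j)) := fun v j => rfl
  have hH : H.map K.subtype = U * (S * U.transpose) := by
    ext i j
    rfl
  have hdet : IsUnit (U * (S * U.transpose)).det := by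
    rw [Matrix.det_mul, Matrix.det_mul, Matrix.det_transpose]
    exact hU.mul (hS.mul hU)
  have hHdet : IsUnit H.det := by
    rw [← hH, ← RingHom.mapMatrix_apply, ← RingHom.map_det] at hdet
    rw [isUnit_iff_ne_zero] at hdet ⊢
    exact fun h0 => hdet (by rw [h0, map_zero])
  have hch : Matrix.vecMul c (H.map K.subtype) = fun j => K.subtype (h j) := by
    rw [hH, ← Matrix.vecMul_vecMul, hc]
    funext j
    exact hent w j
  have hdh : Matrix.vecMul (fun j => K.subtype (Matrix.vecMul h H⁻¹ j)) (H.map K.subtype) =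
      fun j => K.subtype (h j) := by
    funext j
    rw [← Function.comp_def K.subtype, ← RingHom.map_vecMul, Matrix.vecMul_vecMul,
      Matrix.nonsing_inv_mul _ hHdet, Matrix.vecMul_one]
  have hinj : Function.Injective fun v => Matrix.vecMul v (H.map K.subtype) := by
    rw [Matrix.vecMul_injective_iff_isUnit, Matrix.isUnit_iff_isUnit_det, hH]
    exact hdet
  rw [hinj (hch.trans hdh.symm)]
  exact (Matrix.vecMul h H⁻¹ i).2

end Gram

/-! ### Bilinear forms defined over the base field -/

section Form

variable {F L : Type*} [Field F] [Field L] [Algebra F L] {n : ℕ}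

/-- The bilinear form with Gram matrix `S` over `F`, extended to vectors over `L`. -/
def bilin (S : Matrix (Fin n) (Fin n) F) (y z : Fin n → L) : L :=
  dotProduct y ((S.map (algebraMap F L)).mulVec z)

theorem bilin_eq_sum (S : Matrix (Fin n) (Fin n) F) (y z : Fin n → L) :
    bilin S y z = ∑ i, ∑ j, y i * (algebraMap F L (S i j) * z j) := by
  simp [bilin, dotProduct, Matrix.mulVec, Finset.mul_sum]

theorem bilin_comm {S : Matrix (Fin n) (Fin n) F} (hS : S.IsSymm) (y z : Fin n → L) :
    bilin S y z = bilin S z y := by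
  rw [bilin_eq_sum, bilin_eq_sum, Finset.sum_comm]
  refine Finset.sum_congr rfl fun j _ => Finset.sum_congr rfl fun i _ => ?_
  rw [← hS.apply i j]
  ring

theorem map_bilin {L' : Type*} [Field L'] [Algebra F L'] (g : L →ₐ[F] L')
    (S : Matrix (Fin n) (Fin n) F) (y z : Fin n → L) :
    g (bilin S y z) = bilin S (fun j => g (y j)) fun j => g (z j) := by
  simp [bilin_eq_sum]

theorem bilin_vecMul (S T : Matrix (Fin n) (Fin n) F) (y z : Fin n → L) :
    bilin S (Matrix.vecMul y (T.map (algebraMap F L))) (Matrix.vecMul z (T.map (algebraMap F L))) =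
      bilin (T * S * T.transpose) y z := by
  rw [bilin, bilin, Matrix.map_mul, Matrix.map_mul, Matrix.transpose_map, ← Matrix.mulVec_mulVec,
    ← Matrix.mulVec_mulVec, Matrix.mulVec_transpose, Matrix.dotProduct_mulVec y]

theorem bilin_sum_smul_right {m : ℕ} (S : Matrix (Fin n) (Fin n) F) (y : Fin n → L)
    (c : Fin m → L) (U : Matrix (Fin m) (Fin n) L) :
    bilin S y (Matrix.vecMul c U) = ∑ i, c i * bilin S y (U i) := by
  have h : ∀ z, bilin S y z = dotProduct (Matrix.vecMul y (S.map (algebraMap F L))) z :=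
    fun z => Matrix.dotProduct_mulVec _ _ _
  simp only [h]
  rw [dotProduct_comm, ← Matrix.dotProduct_mulVec]
  refine Finset.sum_congr rfl fun i _ => ?_
  rw [Matrix.mulVec, dotProduct_comm (U i)]

theorem bilin_single_left (S : Matrix (Fin n) (Fin n) F) (a : Fin n) (z : Fin n → L) :
    bilin S (Pi.single a 1) z = ∑ j, S a j • z j := by
  rw [bilin, single_one_dotProduct, Matrix.mulVec, dotProduct]
  simp [Algebra.smul_def]

theorem isUnit_det_map {S : Matrix (Fin n) (Fin n) F} (hS : IsUnit S.det) :
    IsUnit (S.map (algebraMap F L)).det := by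
  rw [← RingHom.mapMatrix_apply, ← RingHom.map_det]
  exact hS.map _

theorem exists_vecMul_eq {U : Matrix (Fin n) (Fin n) L} (hU : IsUnit U.det) (w : Fin n → L) :
    ∃ c, Matrix.vecMul c U = w :=
  ⟨Matrix.vecMul w U⁻¹, by rw [Matrix.vecMul_vecMul, Matrix.nonsing_inv_mul _ hU,
    Matrix.vecMul_one]⟩

end Form

/-! ### Values of the form at Frobenius twists -/

section Invariants

/-- The vector of `q ^ k`-th powers of the coordinates, where `q` is the order of `F`. -/
def frobVec (F : Type*) {L : Type*} [Fintype F] [Field L] {n : ℕ} (x : Fin n → L) (k : ℕ) :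
    Fin n → L :=
  fun j => x j ^ Fintype.card F ^ k

theorem frobVec_zero {F L : Type*} [Fintype F] [Field L] {n : ℕ} (x : Fin n → L) :
    frobVec F x 0 = x := by
  funext j
  simp [frobVec]

variable {F L : Type*} [Field F] [Fintype F] [Field L] [Algebra F L] {n : ℕ}

theorem bilin_frobVec_add (S : Matrix (Fin n) (Fin n) F) (x : Fin n → L) (i k : ℕ) :
    bilin S (frobVec F x i) (frobVec F x (i + k)) =
      bilin S x (frobVec F x k) ^ Fintype.card F ^ i := by
  rw [← frobeniusAlgHom_pow_apply (F := F), map_bilin]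
  refine congrArg₂ (bilin S) ?_ ?_ <;> funext j
  · rw [frobeniusAlgHom_pow_apply, frobVec]
  · rw [frobeniusAlgHom_pow_apply, frobVec, frobVec, ← pow_mul, ← pow_add, add_comm]

theorem bilin_frobVec_mem {S : Matrix (Fin n) (Fin n) F} (hS : S.IsSymm) {x : Fin n → L}
    (K : IntermediateField F L) {m : ℕ} (hK : ∀ k ≤ m, bilin S x (frobVec F x k) ∈ K)
    {i j : ℕ} (hij : i ≤ j + m) (hji : j ≤ i + m) :
    bilin S (frobVec F x i) (frobVec F x j) ∈ K := by
  rcases le_total i j with h | h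
  · obtain ⟨k, rfl⟩ := Nat.exists_eq_add_of_le h
    rw [bilin_frobVec_add]
    exact pow_mem (hK k (by omega)) _
  · obtain ⟨k, rfl⟩ := Nat.exists_eq_add_of_le h
    rw [bilin_comm hS, bilin_frobVec_add]
    exact pow_mem (hK k (by omega)) _

/-- A linear functional `bilin S e` with `e` over `F` and value in `K` at `x` makes the last form
redundant: `e` and the first `n - 1` Frobenius twists of `x` form a basis, and the next twist has
coordinates in `K` with respect to it. -/
theorem bilin_frobVec_mem_of_row_mem {m : ℕ} {S : Matrix (Fin (m + 1)) (Fin (m + 1)) F}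
    (hS : S.IsSymm) (hdet : IsUnit S.det) {x : Fin (m + 1) → L} (hx : LinearIndependent F x)
    (K : IntermediateField F L) (hK : ∀ k ≤ m, bilin S x (frobVec F x k) ∈ K)
    (a : Fin (m + 1)) (ha : ∑ j, S a j • x j ∈ K) :
    bilin S x (frobVec F x (m + 1)) ∈ K := by
  let e : Fin (m + 1) → L := Pi.single a 1
  let U : Matrix (Fin (m + 1)) (Fin (m + 1)) L :=
    Matrix.of (Fin.cons e fun i : Fin m => frobVec F x (i + 1))
  have hU0 : U 0 = e := rfl
  have hU : IsUnit U.det := by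
    rw [isUnit_iff_ne_zero]
    intro h0
    obtain ⟨c, hc, h⟩ := Matrix.exists_vecMul_eq_zero_iff.mpr h0
    have hj : ∀ j, c 0 * e j + ∑ i : Fin m, c i.succ * frobVec F x (i + 1) j = 0 := by
      intro j
      have h' : ∑ i, c i * U i j = 0 := congrFun h j
      rwa [Fin.sum_univ_succ] at h'
    -- Away from the index `a` the vector `e` vanishes, and a relation among the twists restricts
    -- to a Moore relation in `m` unknowns, with the `q`-th powers of the `x j` as points.
    have hx' : LinearIndependent F fun j : Fin m => x (a.succAbove j) ^ Fintype.card F ^ 1 :=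
      linearIndependent_pow_card (hx.comp a.succAbove Fin.succAbove_right_injective) 1
    have hs : (fun i : Fin m => c i.succ) = 0 := by
      refine moore_injective hx' fun j => ?_
      have := hj (a.succAbove j)
      rw [show e (a.succAbove j) = 0 from Pi.single_eq_of_ne (Fin.succAbove_ne a j) _,
        mul_zero, zero_add] at this
      simpa only [frobVec, ← pow_mul, ← pow_add, add_comm 1] using this
    have h00 : c 0 = 0 := by
      have := hj a
      simpa [e, fun i => (congrFun hs i : c (Fin.succ i) = 0)] using this
    exact hc (funext fun i => Fin.cases h00 (fun i => congrFun hs i) i)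
  have he : ∀ k, bilin S e (frobVec F x k) ∈ K := by
    intro k
    rw [bilin_single_left]
    simp only [frobVec]
    rw [← sum_smul_pow_card_pow]
    exact pow_mem ha _
  have hee : bilin S e e ∈ K := by
    rw [bilin_single_left]
    refine sum_mem fun j _ => ?_
    by_cases h : j = a
    · subst h
      simp [e, Algebra.smul_def]
    · simp [e, h]
  obtain ⟨c, hc⟩ := exists_vecMul_eq hU (frobVec F x (m + 1))
  have hcK : ∀ i, c i ∈ K := by
    refine coord_mem_of_gram_mem K.toSubfield (isUnit_det_map hdet) hU hc ?_ ?_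
    · intro i j
      change bilin S (U i) (U j) ∈ K
      refine Fin.cases ?_ (fun i => ?_) i <;> refine Fin.cases ?_ (fun j => ?_) j
      · exact hee
      · exact he _
      · rw [bilin_comm hS]
        exact he _
      · exact bilin_frobVec_mem hS K hK (by omega) (by omega)
    · intro j
      change bilin S _ (U j) ∈ K
      refine Fin.cases ?_ (fun j => ?_) j
      · rw [bilin_comm hS]
        exact he _
      · exact bilin_frobVec_mem hS K hK (by omega) (by omega)
  rw [← hc, bilin_sum_smul_right]
  refine sum_mem fun i _ => mul_mem (hcK i) ?_
  refine Fin.cases ?_ (fun i => ?_) i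
  · rw [bilin_comm hS, hU0]
    simpa only [frobVec_zero] using he 0
  · exact hK _ (by omega)

/-- The coefficients of the additive polynomial whose roots are the `F`-span of the `x j` belong to
every subfield over `F` containing the values `bilin S x (frobVec F x k)` for `k ≤ n`. -/
theorem exists_additive_relation {S : Matrix (Fin n) (Fin n) F}
    (hS : S.IsSymm) (hdet : IsUnit S.det) {x : Fin n → L} (hx : LinearIndependent F x)
    (K : IntermediateField F L) (hK : ∀ k ≤ n, bilin S x (frobVec F x k) ∈ K) :
    ∃ c : Fin n → K, ∀ j,
      x j ^ Fintype.card F ^ n = ∑ i, (c i : L) * x j ^ Fintype.card F ^ (i : ℕ) := by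
  obtain ⟨c, hc⟩ := exists_vecMul_eq (isUnit_det_moore hx) (frobVec F x n)
  have hcK : ∀ i, c i ∈ K := by
    refine coord_mem_of_gram_mem K.toSubfield (isUnit_det_map hdet) (isUnit_det_moore hx) hc ?_ ?_
    · exact fun i j => bilin_frobVec_mem hS K hK (by omega) (by omega)
    · exact fun j => bilin_frobVec_mem hS K hK (by omega) (by omega)
  exact ⟨fun i => ⟨c i, hcK i⟩, fun j => (congrFun hc j).symm⟩

/-- A linear substitution preserving all `bilin S x (frobVec F x k)` for `k < n` preserves `S`: the
Frobenius twists of `x` span `L ^ n`, so the form is determined by these values. -/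
theorem mul_mul_transpose_eq_of_bilin_eq {S T : Matrix (Fin n) (Fin n) F} {x : Fin n → L}
    (hx : LinearIndependent F x)
    (h : ∀ k < n, bilin (T * S * T.transpose) x (frobVec F x k) = bilin S x (frobVec F x k)) :
    T * S * T.transpose = S := by
  set R := T * S * T.transpose
  have hM := isUnit_det_moore hx
  let y : Fin n → L := Matrix.vecMul x ((R - S).map (algebraMap F L))
  have hy : y = 0 := by
    refine Matrix.eq_zero_of_mulVec_eq_zero hM.ne_zero ?_
    funext k
    change dotProduct (frobVec F x k) y = 0
    rw [dotProduct_comm, ← Matrix.dotProduct_mulVec, Matrix.map_sub _ (map_sub _),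
      Matrix.sub_mulVec, dotProduct_sub, sub_eq_zero]
    exact h k k.2
  have hij : ∀ j i, (R - S) i j = 0 := by
    intro j
    refine Fintype.linearIndependent_iff.mp hx (fun i => (R - S) i j) ?_
    refine Eq.trans (Finset.sum_congr rfl fun i _ => ?_) (congrFun hy j)
    rw [Algebra.smul_def, mul_comm]
    rfl
  ext i j
  exact sub_eq_zero.mp (hij j i)

theorem vecMul_frobVec (T : Matrix (Fin n) (Fin n) F) (x : Fin n → L) (k : ℕ) :
    frobVec F (Matrix.vecMul x (T.map (algebraMap F L))) k =
      Matrix.vecMul (frobVec F x k) (T.map (algebraMap F L)) := by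
  funext j
  have h : ∀ y : Fin n → L, Matrix.vecMul y (T.map (algebraMap F L)) j = ∑ i, T i j • y i :=
    fun y => by simp [Matrix.vecMul, dotProduct, Algebra.smul_def, mul_comm]
  rw [frobVec, h, h, sum_smul_pow_card_pow]
  rfl

/-- If `x` generates `L` over `F`, a subfield containing `bilin S x (frobVec F x k)` for `k ≤ n`
contains every element fixed by the automorphisms that act on `x` through matrices preserving
`S`. -/
theorem mem_of_fixed {S : Matrix (Fin n) (Fin n) F}
    (hS : S.IsSymm) (hdet : IsUnit S.det) {x : Fin n → L} (hx : LinearIndependent F x)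
    (hgen : IntermediateField.adjoin F (Set.range x) = ⊤)
    (K : IntermediateField F L) (hK : ∀ k ≤ n, bilin S x (frobVec F x k) ∈ K) {f : L}
    (hf : ∀ (τ : L ≃ₐ[F] L) (T : Matrix (Fin n) (Fin n) F), T * S * T.transpose = S →
      (fun j => τ (x j)) = Matrix.vecMul x (T.map (algebraMap F L)) → τ f = f) :
    f ∈ K := by
  obtain ⟨c, hc⟩ := exists_additive_relation hS hdet hx K hK
  obtain ⟨hgal, hτ⟩ := isGalois_of_additive_relation hx hgen K c hc
  have hbot : f ∈ (⊥ : IntermediateField K L) := by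
    rw [InfiniteGalois.mem_bot_iff_fixed]
    intro τ
    choose t ht using hτ τ
    let T : Matrix (Fin n) (Fin n) F := Matrix.of fun i j => t j i
    have hT : (fun j => τ (x j)) = Matrix.vecMul x (T.map (algebraMap F L)) := by
      funext j
      rw [← ht j]
      refine Finset.sum_congr rfl fun i _ => ?_
      rw [Algebra.smul_def, mul_comm]
      rfl
    refine hf (τ.restrictScalars F) T (mul_mul_transpose_eq_of_bilin_eq hx fun k hk => ?_) hT
    rw [← bilin_vecMul, ← vecMul_frobVec, ← hT]
    have hfix := τ.commutes ⟨_, hK k hk.le⟩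
    change τ (bilin S x (frobVec F x k)) = bilin S x (frobVec F x k) at hfix
    rw [← hfix]
    have := map_bilin ((τ.restrictScalars F : L ≃ₐ[F] L) : L →ₐ[F] L) S x (frobVec F x k)
    have hpow : (fun j => τ (frobVec F x k j)) = frobVec F (fun j => τ (x j)) k :=
      funext fun j => map_pow τ (x j) _
    rw [← hpow]
    exact this.symm
  obtain ⟨y, rfl⟩ := IntermediateField.mem_bot.mp hbot
  exact y.2

end Invariants

/-! ### The field of rational functions and its invariants -/

section RationalFunctions

variable {F : Type*} [Field F] {n : ℕ}

theorem linearIndependent_ratX : LinearIndependent F (ratX : Fin n → RatFunc n F) :=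
  (linearIndependent_X (Fin n) F).map'
    (Algebra.algHom F (MvPolynomial (Fin n) F) (RatFunc n F)).toLinearMap
    (LinearMap.ker_eq_bot.mpr (IsFractionRing.injective (MvPolynomial (Fin n) F) (RatFunc n F)))

theorem adjoin_range_ratX :
    IntermediateField.adjoin F (Set.range (ratX : Fin n → RatFunc n F)) = ⊤ := by
  set E := IntermediateField.adjoin F (Set.range (ratX : Fin n → RatFunc n F))
  have hpoly : ∀ p : MvPolynomial (Fin n) F, algebraMap _ (RatFunc n F) p ∈ E := by
    intro p
    induction p using MvPolynomial.induction_on with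
    | C a =>
      rw [← MvPolynomial.algebraMap_eq, ← IsScalarTower.algebraMap_apply]
      exact E.algebraMap_mem a
    | add p q hp hq =>
      rw [map_add]
      exact add_mem hp hq
    | mul_X p i hp =>
      rw [map_mul]
      exact mul_mem hp (IntermediateField.subset_adjoin F _ ⟨i, rfl⟩)
  rw [eq_top_iff]
  intro f _
  obtain ⟨p, q, -, rfl⟩ := IsFractionRing.div_surjective (A := MvPolynomial (Fin n) F) f
  exact div_mem (hpoly p) (hpoly q)

theorem algEquiv_ext_ratX {τ τ' : RatFunc n F ≃ₐ[F] RatFunc n F}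
    (h : ∀ j, τ (ratX j) = τ' (ratX j)) : τ = τ' := by
  have : (τ : RatFunc n F →ₐ[F] RatFunc n F) = τ' := by
    refine IsLocalization.algHom_ext (nonZeroDivisors (MvPolynomial (Fin n) F)) ?_
    exact MvPolynomial.algHom_ext h
  exact AlgEquiv.ext fun f => DFunLike.congr_fun this f

theorem sigma_ratX_eq_vecMul (T : GL (Fin n) F) :
    (fun j => sigma T (ratX j)) = Matrix.vecMul ratX (T.val.map (algebraMap F (RatFunc n F))) :=
  funext fun j => sigma_ratX T j

theorem formP_eq_bilin [Fintype F] (S : Matrix (Fin n) (Fin n) F) (k : ℕ) :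
    formP S k = bilin S (ratX : Fin n → RatFunc n F) (frobVec F ratX k) :=
  rfl

theorem sigma_formP [Fintype F] {S : Matrix (Fin n) (Fin n) F} {T : GL (Fin n) F}
    (hT : T ∈ congruenceGroup S) (k : ℕ) : sigma T (formP S k) = formP S k := by
  have hTS : T.val * S * T.val.transpose = S := hT
  have h := map_bilin (sigma T : RatFunc n F →ₐ[F] RatFunc n F) S ratX (frobVec F ratX k)
  have hpow : (fun j => sigma T (frobVec F (ratX : Fin n → RatFunc n F) k j)) =
      frobVec F (fun j => sigma T (ratX j)) k :=
    funext fun j => map_pow (sigma T) (ratX j) _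
  rw [formP_eq_bilin]
  refine h.trans ?_
  change bilin S (fun j => sigma T (ratX j)) (fun j => sigma T (frobVec F ratX k j)) = _
  rw [hpow, sigma_ratX_eq_vecMul, vecMul_frobVec, bilin_vecMul, hTS]

/-- A field containing `formP S 0, …, formP S n` contains the invariants of the group of `S`. -/
theorem invariantField_le [Fintype F] {S : Matrix (Fin n) (Fin n) F}
    (hS : S.IsSymm) (hdet : IsUnit S.det) (K : IntermediateField F (RatFunc n F))
    (hK : ∀ k ≤ n, formP S k ∈ K) : invariantField (congruenceGroup S) ≤ K := by
  intro f hf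
  rw [mem_invariantField] at hf
  refine mem_of_fixed hS hdet linearIndependent_ratX adjoin_range_ratX K hK fun τ T hT hτ => ?_
  have hTdet : IsUnit T.det := by
    have h := congrArg Matrix.det hT
    rw [Matrix.det_mul, Matrix.det_mul, Matrix.det_transpose] at h
    rw [isUnit_iff_ne_zero] at hdet ⊢
    intro h0
    exact hdet (by rw [← h, h0, mul_zero])
  obtain ⟨U, rfl⟩ := (Matrix.isUnit_iff_isUnit_det T).mpr hTdet
  have hτU : τ = sigma U :=
    algEquiv_ext_ratX fun j => (congrFun hτ j).trans (congrFun (sigma_ratX_eq_vecMul U) j).symm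
  rw [hτU]
  exact hf U hT

end RationalFunctions

/-! ### The matrix of the pseudo-symplectic group -/

section MatrixS

variable (ν : ℕ) (F : Type*) [Field F]

theorem matrixS_isSymm : (matrixS ν F).IsSymm := by
  rw [Matrix.IsSymm, matrixS, Matrix.transpose_reindex, Matrix.fromBlocks_transpose,
    Matrix.fromBlocks_transpose]
  congr 2
  · simp
  · ext i j
    fin_cases i <;> fin_cases j <;> rfl

theorem isUnit_det_matrixS : IsUnit (matrixS ν F).det := by
  rw [matrixS, Matrix.det_reindex_self, Matrix.det_fromBlocks_zero₂₁]
  refine IsUnit.mul (Matrix.isUnit_det_of_left_inverse (B := Matrix.fromBlocks 0 1 1 0) ?_) ?_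
  · simp [Matrix.fromBlocks_multiply]
  · simp [Matrix.det_fin_two]

theorem blockIndex_inr_one : blockIndex ν (Sum.inr 1) = Fin.last (2 * ν + 1) := by
  ext
  simp [blockIndex]

/-- The last coordinate is the value of the form at the basis vector with index `2ν` (counting from
`0`), the first one of the `2 × 2` block. -/
theorem sum_matrixS_row_smul {L : Type*} [Field L] [Algebra F L] (x : Fin (2 * ν + 2) → L) :
    ∑ j, matrixS ν F (blockIndex ν (Sum.inr 0)) j • x j = x (Fin.last (2 * ν + 1)) := by
  rw [← (blockIndex ν).sum_comp, ← blockIndex_inr_one]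
  simp [matrixS]

/-- In characteristic `2` the off-diagonal terms cancel in pairs, and the only nonzero diagonal
entry is the last one. -/
theorem bilin_matrixS_self [CharP F 2] {L : Type*} [Field L] [Algebra F L]
    (x : Fin (2 * ν + 2) → L) :
    bilin (matrixS ν F) x x = x (Fin.last (2 * ν + 1)) ^ 2 := by
  have : CharP L 2 := charP_of_injective_algebraMap (algebraMap F L).injective 2
  rw [bilin_eq_sum, ← (blockIndex ν).sum_comp, ← blockIndex_inr_one]
  simp only [← (blockIndex ν).sum_comp (fun j => _ * (_ * x j))]
  simp [matrixS, Matrix.one_apply, Fintype.sum_sum_type, mul_comm, CharTwo.add_self_eq_zero]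
  rw [← add_assoc, CharTwo.add_self_eq_zero, zero_add, sq]

end MatrixS

end PseudoSymplectic

theorem theorem4p3 {F : Type*} [Field F] [Fintype F] [CharP F 2] (ν : ℕ) :
    PseudoSymplectic.invariantField (PseudoSymplectic.Ps ν F) =
      IntermediateField.adjoin F
        ((fun k : ℕ => PseudoSymplectic.formP (PseudoSymplectic.matrixS ν F) k) ''
            Set.Icc 1 (2 * ν + 1) ∪
          {PseudoSymplectic.ratX (Fin.last (2 * ν + 1))}) := by
  open PseudoSymplectic in
  have hsq : formP (matrixS ν F) 0 = ratX (Fin.last (2 * ν + 1)) ^ 2 := by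
    rw [formP_eq_bilin, frobVec_zero, bilin_matrixS_self]
  apply le_antisymm
  · set K := IntermediateField.adjoin F
      ((fun k : ℕ => formP (matrixS ν F) k) '' Set.Icc 1 (2 * ν + 1) ∪
        {ratX (Fin.last (2 * ν + 1))})
    have hlast : ratX (Fin.last (2 * ν + 1)) ∈ K :=
      IntermediateField.subset_adjoin F _ (Or.inr rfl)
    have hK : ∀ k ≤ 2 * ν + 1, formP (matrixS ν F) k ∈ K := by
      intro k hk
      rcases Nat.eq_zero_or_pos k with rfl | hpos
      · rw [hsq]
        exact pow_mem hlast 2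
      · exact IntermediateField.subset_adjoin F _ (Or.inl ⟨k, ⟨hpos, hk⟩, rfl⟩)
    refine invariantField_le (matrixS_isSymm ν F) (isUnit_det_matrixS ν F) K fun k hk => ?_
    rcases Nat.lt_or_eq_of_le hk with h | rfl
    · exact hK k (by omega)
    -- `formP S (2ν + 2)` is not among the generators; the invariant `X_n` makes it redundant.
    · refine bilin_frobVec_mem_of_row_mem (matrixS_isSymm ν F) (isUnit_det_matrixS ν F)
        linearIndependent_ratX K hK (blockIndex ν (Sum.inr 0)) ?_
      rw [sum_matrixS_row_smul]
      exact hlast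
  · rw [IntermediateField.adjoin_le_iff]
    rintro _ (⟨k, -, rfl⟩ | rfl)
    · exact (mem_invariantField _ _).mpr fun T hT => sigma_formP hT k
    -- `X_n` is invariant because its square is the value of the form at `k = 0` and squaring is
    -- injective in characteristic `2`.
    · refine (mem_invariantField _ _).mpr fun T hT => ?_
      have : CharP (RatFunc (2 * ν + 2) F) 2 :=
        charP_of_injective_algebraMap (algebraMap F _).injective 2
      have h := sigma_formP hT 0
      rw [hsq, map_pow] at h
      exact CharTwo.sq_injective h
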